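/- Theorem 3. Let $X\subseteq\mathbb R^n$ (state set), $U\subseteq\mathbb R^m$ (input set), $T>0$. "$C^1$ on a set" means $C^1$ on a neighbourhood of each of its points. Let $f:X\to\mathbb R^n$, $g:X\to\mathbb R^{n\times m}$, $h,h_b:X\to\mathbb R$, the backup controller $k_b:X\to U$, and the disturbance $d:[0,\infty)\to\mathbb R^n$ be $C^1$, and let $p,q:[0,\infty)\times X\times U\times\mathbb R^n\to\mathbb R^n$ be $C^1$. Put $f_{cl}=f+g\,k_b$ and $C_S=\{x\in X: h(x)\ge 0\}$, and assume $\nabla h(x)\ne 0$ at all boundary points $x$ of $C_S$ with $h(x)=0$. Let $k:X\to U$ be locally Lipschitz, let $0\le t_0$, and let $(x,\xi)$ be a solution on $[t_0,t_1]$, with $x(t)\in X$, of the disturbed closed loop with estimator $$\dot x=f(x)+g(x)k(x)+d(t),\qquad \dot\xi=p(t,x,k(x),\xi),\qquad \hat d(t)=q(t,x(t),k(x(t)),\xi(t)),$$ and put $e(t)=d(t)-\hat d(t)$. Assume that $x(t)$ lies in the interior of $X$ whenever $h(x(t))=0$. For $x\in C_S$ and $t\in[t_0,t_1]$ let $\phi_b^{d}(\tau,x)$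 and $\phi_b^{\hat d}(\tau,x)$ be the solutions on $[0,T]$, starting at $x$ at $\tau=0$, of $\partial_\tau\phi_b^{d}=f_{cl}(\phi_b^{d})+d(\tau+t)$ and of $\partial_\tau\phi_b^{\hat d}=f_{cl}(\phi_b^{\hat d})+\hat d(t)$ (with $\hat d(t)$ held constant); both are assumed to exist on $[0,T]$ and to stay in $X$. Let $\Phi(\tau,x)=\partial\phi_b^{\hat d}(\tau,x)/\partial x$ and $\Theta(\tau,x)=\partial\phi_b^{\hat d}(\tau,x)/\partial\hat d$. Define $$C_D(t)=\{x\in X: h(\phi_b^{d}(\tau,x))\ge 0\ \ \forall\tau\in[0,T],\ \ h_b(\phi_b^{d}(T,x))\ge 0\},$$ $$\widehat C_D(t)=\{x\in X: h(\phi_b^{\hat d}(\tau,x))\ge \epsilon_\tau(t)\ \ \forall\tau\in[0,T],\ \ h_b(\phi_b^{\hat d}(T,x))\ge \epsilon_b(t)\}.$$ Here $\epsilon_\tau$ $(\tau\in[0,T])$ and $\epsilon_b$ are $C^1$ functions of $t\ge0$ with $\epsilon_\tau(t)\ge L_h\,\delta_{\max}(\tau,t)$ and $\epsilon_b(t)\ge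 L_{h_b}\,\delta_{\max}(T,t)$ for $t\in[t_0,t_1]$, where $L_h,L_{h_b}$ are Lipschitz constants of $h,h_b$ on $X$, and $\delta_{\max}(\tau,t)\ge 0$ satisfies $\|\phi_b^{d}(\tau,x)-\phi_b^{\hat d}(\tau,x)\|\le\delta_{\max}(\tau,t)$ for all $x\in C_S$, $\tau\in[0,T]$, $t\in[t_0,t_1]$. Let $\alpha,\alpha_b:\mathbb R\to\mathbb R$ be continuous and strictly increasing, vanish at $0$, and tend to $\infty$ at $\infty$. Suppose that for all $\tau\in[0,T]$, $t\in[t_0,t_1]$ and $x\in C_S$, with $u=k(x)$, $$\nabla h(\phi_b^{\hat d}(\tau,x))\,\Phi(\tau,x)\big(f(x)+g(x)u+\hat d(t)\big)\ \ge\ -\alpha\big(h(\phi_b^{\hat d}(\tau,x))-\epsilon_\tau(t)\big)+\frac{\partial\epsilon_\tau}{\partial t}(t)+\rho,$$ $$\nabla h_b(\phi_b^{\hat d}(T,x))\,\Phi(T,x)\big(f(x)+g(x)u+\hat d(t)\big)\ \ge\ -\alpha_b\big(h_b(\phi_b^{\hat d}(T,x))-\epsilon_b(t)\big)+\frac{\partial\epsilon_b}{\partial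 t}(t)+\rho_b,$$ where the robustness terms $\rho=\rho(\tau,t,x)$ and $\rho_b=\rho_b(t,x)$ satisfy, at every $t\in(t_0,t_1)$ at which $\hat d$ is differentiable, $$\rho\ \ge\ -\nabla h(\phi_b^{\hat d}(\tau,x))\Big(\Phi(\tau,x)e(t)+\Theta(\tau,x)\tfrac{d}{dt}\hat d(t)\Big),\qquad \rho_b\ \ge\ -\nabla h_b(\phi_b^{\hat d}(T,x))\Big(\Phi(T,x)e(t)+\Theta(T,x)\tfrac{d}{dt}\hat d(t)\Big).$$ Then $\widehat C_D(t)\subseteq C_D(t)\subseteq C_S$ for all $t\in[t_0,t_1]$, and $\widehat C_D$ is forward invariant along the trajectory: if $s\in[t_0,t_1]$ and $x(s)\in\widehat C_D(s)$, then $x(t)\in\widehat C_D(t)$ for all $t\in[s,t_1]$ (so the trajectory stays in $C_S$). -/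

import Mathlib

open Set Filter Topology
open scoped NNReal

/-- The state space `ℝⁿ` (and the input space `ℝᵐ`) with the Euclidean norm. -/
abbrev Vec (n : ℕ) : Type := EuclideanSpace ℝ (Fin n)

/-- `φ` is continuously differentiable on `S`, in the sense that it is `C¹` on a neighbourhood
of each point of `S`, i.e. on an open set containing `S`. -/
def C1On {E F : Type*} [NormedAddCommGroup E] [NormedSpace ℝ E] [NormedAddCommGroup F]
    [NormedSpace ℝ F] (S : Set E) (φ : E → F) : Prop :=
  ∀ z ∈ S, ContDiffAt ℝ 1 φ z

/-- A class-`K∞` function, extended to negative arguments as a strictly increasing function. -/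
structure IsClassKInfty (α : ℝ → ℝ) : Prop where
  continuous : Continuous α
  strictMono : StrictMono α
  map_zero : α 0 = 0
  tendsto_atTop : Tendsto α atTop atTop

/-- The backup closed-loop vector field `f_cl(x) = f(x) + g(x) k_b(x)`. -/
def backupField {n m : ℕ} (f : Vec n → Vec n) (g : Vec n → Vec m →L[ℝ] Vec n)
    (kb : Vec n → Vec m) (x : Vec n) : Vec n :=
  f x + g x (kb x)

/-- `γ` solves `γ' = F(τ, γ)`, `γ(0) = x` on the horizon `[0, T]`. -/
def IsArc {n : ℕ} (F : ℝ → Vec n → Vec n) (T : ℝ) (x : Vec n) (γ : ℝ → Vec n) : Prop :=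
  γ 0 = x ∧ ∀ τ ∈ Icc (0 : ℝ) T, HasDerivWithinAt γ (F τ (γ τ)) (Icc (0 : ℝ) T) τ

open Classical in
/-- The flow at time `τ ∈ [0, T]` of the (possibly time-dependent) vector field `F` from `x`:
the value of the solution on `[0, T]` (the constant `x` if there is none). -/
noncomputable def flow {n : ℕ} (F : ℝ → Vec n → Vec n) (T τ : ℝ) (x : Vec n) : Vec n :=
  if H : ∃ γ : ℝ → Vec n, IsArc F T x γ then Classical.choose H τ else x

/-- The vector field of the estimate flow: the disturbance estimate `v` is frozen along it. -/
def estField {n : ℕ} (fcl : Vec n → Vec n) (v : Vec n) : ℝ → Vec n → Vec n :=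
  fun _ y => fcl y + v

/-- The vector field of the disturbed backup flow started at global time `t`. -/
def distField {n : ℕ} (fcl : Vec n → Vec n) (d : ℝ → Vec n) (t : ℝ) : ℝ → Vec n → Vec n :=
  fun τ y => fcl y + d (τ + t)

/-- The backup flow under the frozen disturbance estimate `v`. -/
noncomputable def estFlow {n : ℕ} (fcl : Vec n → Vec n) (T : ℝ) (v : Vec n) (τ : ℝ)
    (x : Vec n) : Vec n :=
  flow (estField fcl v) T τ x

/-- The backup flow under the true disturbance, started at global time `t`. -/
noncomputable def distFlow {n : ℕ} (fcl : Vec n → Vec n) (T : ℝ) (d : ℝ → Vec n) (t τ : ℝ)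
    (x : Vec n) : Vec n :=
  flow (distField fcl d t) T τ x

/-- `Φ(τ, x)`: the derivative of the estimate flow with respect to the initial state. -/
noncomputable def stateSens {n : ℕ} (fcl : Vec n → Vec n) (T : ℝ) (v : Vec n) (τ : ℝ)
    (x : Vec n) : Vec n →L[ℝ] Vec n :=
  fderiv ℝ (fun z => estFlow fcl T v τ z) x

/-- `Θ(τ, x)`: the derivative of the estimate flow with respect to the disturbance estimate. -/
noncomputable def estSens {n : ℕ} (fcl : Vec n → Vec n) (T : ℝ) (v : Vec n) (τ : ℝ)
    (x : Vec n) : Vec n →L[ℝ] Vec n :=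
  fderiv ℝ (fun w => estFlow fcl T w τ x) v

/-- The safe set `C_S = {x ∈ X : h(x) ≥ 0}`. -/
def safeSet {n : ℕ} (X : Set (Vec n)) (h : Vec n → ℝ) : Set (Vec n) :=
  {x | x ∈ X ∧ 0 ≤ h x}

/-- The set `C_D(t)`, defined by the disturbed backup flow. -/
def setCD {n : ℕ} (X : Set (Vec n)) (h hb : Vec n → ℝ) (fcl : Vec n → Vec n) (T : ℝ)
    (d : ℝ → Vec n) (t : ℝ) : Set (Vec n) :=
  {x | x ∈ X ∧ (∀ τ ∈ Icc (0 : ℝ) T, 0 ≤ h (distFlow fcl T d t τ x)) ∧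
    0 ≤ hb (distFlow fcl T d t T x)}

/-- The set `Ĉ_D(t)`, defined by the estimate flow with the tightening terms `ε_τ(t)`, `ε_b(t)`,
where `dhat` is the signal of disturbance estimates. -/
def setCDhat {n : ℕ} (X : Set (Vec n)) (h hb : Vec n → ℝ) (fcl : Vec n → Vec n) (T : ℝ)
    (dhat : ℝ → Vec n) (ε : ℝ → ℝ → ℝ) (εb : ℝ → ℝ) (t : ℝ) : Set (Vec n) :=
  {x | x ∈ X ∧ (∀ τ ∈ Icc (0 : ℝ) T, ε τ t ≤ h (estFlow fcl T (dhat t) τ x)) ∧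
    εb t ≤ hb (estFlow fcl T (dhat t) T x)}

/-- The estimate `d̂(t) = q(t, x(t), u(t), ξ(t))` along a trajectory, with `u = k(x)`. -/
def estimate {n m : ℕ} (q : ℝ × Vec n × Vec m × Vec n → Vec n) (k : Vec n → Vec m)
    (x ξ : ℝ → Vec n) (t : ℝ) : Vec n :=
  q (t, x t, k (x t), ξ t)

/-- `(x, ξ)` solves, on `[t₀, t₁]` and with `x` in `X`, the disturbed system
`x' = f(x) + g(x) k(x) + d(t)` together with the estimator `ξ' = p(t, x, k(x), ξ)`. -/
def IsClosedLoopSolution {n m : ℕ} (X : Set (Vec n)) (f : Vec n → Vec n)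
    (g : Vec n → Vec m →L[ℝ] Vec n) (d : ℝ → Vec n) (p : ℝ × Vec n × Vec m × Vec n → Vec n)
    (k : Vec n → Vec m) (t₀ t₁ : ℝ) (x ξ : ℝ → Vec n) : Prop :=
  ∀ t ∈ Icc t₀ t₁, x t ∈ X ∧
    HasDerivWithinAt x (f (x t) + g (x t) (k (x t)) + d t) (Icc t₀ t₁) t ∧
    HasDerivWithinAt ξ (p (t, x t, k (x t), ξ t)) (Icc t₀ t₁) t

/-- A time-varying set `C` is forward invariant along the trajectory `x` on `[t₀, t₁]`. -/
def ForwardInvariantAlong {n : ℕ} (C : ℝ → Set (Vec n)) (t₀ t₁ : ℝ) (x : ℝ → Vec n) : Prop :=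
  ∀ s ∈ Icc t₀ t₁, x s ∈ C s → ∀ t ∈ Icc s t₁, x t ∈ C t

/-! The inclusions come from the Lipschitz bounds: a margin of at least `L * δmax` on the estimate
flow leaves a nonnegative value on the disturbed flow, and `τ = 0` gives membership in the safe set.

For invariance, fix `τ` and let `H(t)` be the constraint value on the estimate flow from `x(t)`
minus `ε_τ(t)`. The controller is only locally Lipschitz, so the estimate, and with it `H`, is only
Lipschitz in time. At almost every time the chain rule applies; writing `d` as estimate plus error
and using the bound on the robustness term gives `H' ≥ -α(H)`. Hence `H' ≥ 0` almost everywhere on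
`{H < 0}`, and absolute continuity keeps `H ≥ 0` (`le_estFlow_of_barrier`,
`LipschitzOnWith.nonneg_of_ae_deriv_nonneg`). The chain rule needs the flow to be jointly
differentiable in initial state and estimate (`estFlow_differentiableAt_and_lipschitz`), proved
through the variational equation.

This argument is conditional: the constraints hold only over the safe set, so the trajectory must
first be kept there. An exit could occur only at a zero of `h` on the boundary, where the gradient
does not vanish. There the constraint at `τ = 0` is a Nagumo-type tangency condition on the moving
level sets `{h = ε_0(t)}`, and `eventually_le_of_tangent` prevents the exit. A continuous induction
in time closes the loop. -/

/-! ### Existence for truncated and linear ODEs -/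

/-- A bounded, globally Lipschitz, time-dependent vector field has solutions on `[0, T]`. -/
lemma exists_solution_of_bounded_lipschitz {W : Type*} [NormedAddCommGroup W] [NormedSpace ℝ W]
    [CompleteSpace W] {F : ℝ → W → W} {T : ℝ} (hT : 0 ≤ T) {K M : ℝ≥0}
    (hK : ∀ t ∈ Icc 0 T, LipschitzWith K (F t)) (hM : ∀ t ∈ Icc 0 T, ∀ y, ‖F t y‖ ≤ M)
    (hc : ∀ y, ContinuousOn (F · y) (Icc 0 T)) (x : W) :
    ∃ γ : ℝ → W, γ 0 = x ∧ ∀ t ∈ Icc 0 T, HasDerivWithinAt γ (F t (γ t)) (Icc 0 T) t := by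
  -- Speed at most `M` cannot leave the ball of radius `M * T` before time `T`, so Picard–Lindelöf
  -- covers the whole horizon.
  have hp : IsPicardLindelof F (⟨0, left_mem_Icc.2 hT⟩ : Icc (0 : ℝ) T) x
      (M * T.toNNReal) 0 M K :=
    { lipschitzOnWith := fun t ht => (hK t ht).lipschitzOnWith
      continuousOn := fun y _ => hc y
      norm_le := fun t ht y _ => hM t ht y
      mul_max_le := by
        simp [hT] }
  exact hp.exists_eq_forall_mem_Icc_hasDerivWithinAt₀

lemma HasDerivWithinAt.Ici_of_Icc {W : Type*} [NormedAddCommGroup W] [NormedSpace ℝ W]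
    {γ : ℝ → W} {w : W} {a b t : ℝ} (h : HasDerivWithinAt γ w (Icc a b) t) (ht : t ∈ Ico a b) :
    HasDerivWithinAt γ w (Ici t) t :=
  (h.mono (Icc_subset_Icc_left ht.1)).mono_of_mem_nhdsWithin (Icc_mem_nhdsGE ht.2)

/-- A linear time-dependent ODE with continuous coefficients has solutions on `[0, T]`. -/
lemma exists_solution_linear {W : Type*} [NormedAddCommGroup W] [NormedSpace ℝ W]
    [FiniteDimensional ℝ W] {A : ℝ → W →L[ℝ] W} {T : ℝ} (hT : 0 ≤ T)
    (hA : ContinuousOn A (Icc 0 T)) (y₀ : W) :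
    ∃ Y : ℝ → W, Y 0 = y₀ ∧ ∀ t ∈ Icc 0 T, HasDerivWithinAt Y (A t (Y t)) (Icc 0 T) t := by
  have : CompleteSpace W := FiniteDimensional.complete ℝ W
  obtain ⟨M, hM⟩ := isCompact_Icc.exists_bound_of_continuousOn hA
  have hM0 : 0 ≤ M := (norm_nonneg _).trans (hM 0 (left_mem_Icc.2 hT))
  -- Grönwall's a priori bound, plus `1` for positivity. The truncation `r` is the identity on this
  -- ball and never increases norms, so the truncated solution obeys the same bound and solves the
  -- linear equation.
  set R : ℝ := ‖y₀‖ * Real.exp (M * T) + 1 with hR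
  have hRpos : 0 < R := by positivity
  let χ : ContDiffBump (0 : W) := ⟨R, R + 1, hRpos, by linarith⟩
  let r : W → W := fun y => χ y • y
  have hr : ContDiff ℝ 1 r := χ.contDiff.smul contDiff_id
  have hrc : HasCompactSupport r := χ.hasCompactSupport.smul_right
  obtain ⟨K, hK⟩ := hr.lipschitzWith_of_hasCompactSupport hrc one_ne_zero
  obtain ⟨B, hB⟩ := hrc.exists_bound_of_continuous hr.continuous
  have hB0 : 0 ≤ B := (norm_nonneg _).trans (hB 0)
  have hrle : ∀ y, ‖r y‖ ≤ ‖y‖ := fun y => by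
    simp only [r, norm_smul, Real.norm_eq_abs, abs_of_nonneg χ.nonneg]
    exact mul_le_of_le_one_left (norm_nonneg _) χ.le_one
  obtain ⟨Y, hY0, hY⟩ := exists_solution_of_bounded_lipschitz (F := fun t y => A t (r y)) hT
    (K := ⟨M, hM0⟩ * K) (M := ⟨M * B, by positivity⟩)
    (fun t ht => ((A t).lipschitz.weaken (by exact_mod_cast hM t ht)).comp hK)
    (fun t ht y => ((A t).le_opNorm _).trans
      (mul_le_mul (hM t ht) (hB y) (norm_nonneg _) hM0))
    (fun y => hA.clm_apply continuousOn_const) y₀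
  refine ⟨Y, hY0, fun t ht => ?_⟩
  have hgr := norm_le_gronwallBound_of_norm_deriv_right_le (f := Y) (f' := fun t => A t (r (Y t)))
    (δ := ‖y₀‖) (K := M) (ε := 0) (a := 0) (b := T)
    (fun t ht => (hY t ht).continuousWithinAt)
    (fun t ht => (hY t (Ico_subset_Icc_self ht)).Ici_of_Icc ht) (by rw [hY0])
    (fun t ht => by
      rw [add_zero]
      exact ((A t).le_opNorm _).trans
        (mul_le_mul (hM t (Ico_subset_Icc_self ht)) (hrle _) (norm_nonneg _) hM0)) t ht
  rw [gronwallBound_ε0, sub_zero] at hgr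
  have hle : ‖Y t‖ ≤ R := hgr.trans <| by
    have : Real.exp (M * t) ≤ Real.exp (M * T) :=
      Real.exp_le_exp.2 (mul_le_mul_of_nonneg_left ht.2 hM0)
    have := mul_le_mul_of_nonneg_left this (norm_nonneg y₀)
    linarith
  have hone : r (Y t) = Y t := by
    simp only [r]
    rw [χ.one_of_mem_closedBall (by simpa using! hle), one_smul]
  simpa only [hone] using hY t ht

/-! ### Differentiable dependence on the initial value -/

/-- Uniform first order expansion of a compactly supported `C¹` map. -/
lemma uniform_expansion_of_hasCompactSupport {P Q : Type*}
    [NormedAddCommGroup P] [NormedSpace ℝ P] [NormedAddCommGroup Q] [NormedSpace ℝ Q]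
    {G : P → Q} (hG : ContDiff ℝ 1 G) (hc : HasCompactSupport G) {η : ℝ} (hη : 0 < η) :
    ∃ δ > (0 : ℝ), ∀ y y₀ : P, dist y y₀ < δ → ‖G y - G y₀ - fderiv ℝ G y₀ (y - y₀)‖ ≤ η * ‖y - y₀‖ := by
  have huc : UniformContinuous (fderiv ℝ G) :=
    (hc.fderiv ℝ).uniformContinuous_of_continuous (hG.continuous_fderiv one_ne_zero)
  obtain ⟨δ, hδ, H⟩ := Metric.uniformContinuous_iff.1 huc η hη
  refine ⟨δ, hδ, fun y y₀ hy => ?_⟩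
  exact (convex_ball y₀ δ).norm_image_sub_le_of_norm_fderiv_le' (𝕜 := ℝ) (φ := fderiv ℝ G y₀)
    (fun z _ => hG.differentiable one_ne_zero z)
    (fun z hz => by rw [← dist_eq_norm]; exact (H hz).le)
    (Metric.mem_ball_self hδ) hy

section Flow

variable {P : Type*} [NormedAddCommGroup P] [NormedSpace ℝ P] {G : P → P} {T : ℝ}
  {ψ : P → ℝ → P}

/-- Solutions of a Lipschitz autonomous ODE depend on the initial value in a Lipschitz way. -/
lemma dist_solution_le {K : ℝ≥0} (hG : LipschitzWith K G) (hψ0 : ∀ p, ψ p 0 = p)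
    (hψ : ∀ p, ∀ t ∈ Icc 0 T, HasDerivWithinAt (ψ p) (G (ψ p t)) (Icc 0 T) t)
    {t : ℝ} (ht : t ∈ Icc 0 T) (p q : P) :
    dist (ψ p t) (ψ q t) ≤ Real.exp (K * T) * dist p q := by
  have := dist_le_of_trajectories_ODE (v := fun _ => G) (fun _ => hG)
    (fun t ht => (hψ p t ht).continuousWithinAt)
    (fun t ht => (hψ p t (Ico_subset_Icc_self ht)).Ici_of_Icc ht)
    (fun t ht => (hψ q t ht).continuousWithinAt)
    (fun t ht => (hψ q t (Ico_subset_Icc_self ht)).Ici_of_Icc ht)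
    (by rw [hψ0, hψ0]) t ht
  rw [sub_zero] at this
  refine this.trans ?_
  rw [mul_comm]
  gcongr
  exact ht.2

/-- The flow of a compactly supported `C¹` vector field is differentiable in the initial value. -/
lemma differentiableAt_solution [FiniteDimensional ℝ P] (hG : ContDiff ℝ 1 G)
    (hGc : HasCompactSupport G) (hψ0 : ∀ p, ψ p 0 = p)
    (hψ : ∀ p, ∀ t ∈ Icc 0 T, HasDerivWithinAt (ψ p) (G (ψ p t)) (Icc 0 T) t)
    {t : ℝ} (ht : t ∈ Icc 0 T) (p : P) : DifferentiableAt ℝ (fun q => ψ q t) p := by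
  have hT : 0 ≤ T := ht.1.trans ht.2
  obtain ⟨K, hK⟩ := hG.lipschitzWith_of_hasCompactSupport hGc one_ne_zero
  have hcont : ContinuousOn (fun s => fderiv ℝ G (ψ p s)) (Icc 0 T) :=
    (hG.continuous_fderiv one_ne_zero).comp_continuousOn
      fun s hs => (hψ p s hs).continuousWithinAt
  -- The variational equation `Y' = DG(ψ) ∘ Y`, `Y(0) = id`, whose solution is the candidate
  -- derivative.
  obtain ⟨Y, hY0, hY⟩ := exists_solution_linear
    (A := fun s => ContinuousLinearMap.compL ℝ P P P (fderiv ℝ G (ψ p s))) hT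
    ((ContinuousLinearMap.continuous _).comp_continuousOn hcont) (ContinuousLinearMap.id ℝ P)
  have hDG : ∀ y, ‖fderiv ℝ G y‖ ≤ K := fun y => norm_fderiv_le_of_lipschitz ℝ hK
  refine HasFDerivAt.differentiableAt (f' := Y t) ?_
  rw [hasFDerivAt_iff_isLittleO, Asymptotics.isLittleO_iff]
  intro c hc
  set C : ℝ := Real.exp (K * T) with hC
  have hCpos : 0 < C := Real.exp_pos _
  set Γ : ℝ := gronwallBound 0 K 1 T with hΓ
  have hΓ0 : 0 ≤ Γ := by
    have := gronwallBound_mono (δ := 0) (K := K) (ε := 1) le_rfl zero_le_one K.2 hT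
    rwa [gronwallBound_x0] at this
  -- `C` is the Lipschitz constant of the flow and `Γ` the Grönwall response to unit forcing, so
  -- this tolerance yields a final error at most `c * ‖q - p‖`. The `+ 1` covers `Γ = 0`, which
  -- occurs for `T = 0`.
  obtain ⟨δ, hδ, hexp⟩ := uniform_expansion_of_hasCompactSupport hG hGc
    (η := c / (C * (Γ + 1))) (by positivity)
  have hev : ∀ᶠ q in 𝓝 p, dist q p < δ / C := Metric.ball_mem_nhds p (by positivity)
  filter_upwards [hev] with q hq
  set η := c / (C * (Γ + 1)) with hη
  have hηpos : 0 < η := by positivity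
  have hgr := norm_le_gronwallBound_of_norm_deriv_right_le
    (f := fun s => ψ q s - ψ p s - Y s (q - p))
    (f' := fun s => G (ψ q s) - G (ψ p s) - fderiv ℝ G (ψ p s) (Y s (q - p)))
    (δ := 0) (K := K) (ε := η * (C * ‖q - p‖)) (a := 0) (b := T)
    (fun s hs => (((hψ q s hs).sub (hψ p s hs)).sub
      ((hY s hs).clm_apply (hasDerivWithinAt_const _ _ (q - p)))).continuousWithinAt)
    (fun s hs => by
      have hs' := Ico_subset_Icc_self hs
      have := (((hψ q s hs').sub (hψ p s hs')).sub
        ((hY s hs').clm_apply (hasDerivWithinAt_const _ _ (q - p)))).Ici_of_Icc hs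
      simpa using! this)
    (by simp [hψ0, hY0])
    (fun s hs => by
      have hs' := Ico_subset_Icc_self hs
      have hd := dist_solution_le hK hψ0 hψ hs' q p
      have hlt : dist (ψ q s) (ψ p s) < δ := hd.trans_lt <| by
        rw [← hC, ← lt_div_iff₀' hCpos]; exact hq
      have h1 := hexp _ _ hlt
      -- The error solves the linearised equation, forced by the Taylor remainder of `G`.
      have h2 : G (ψ q s) - G (ψ p s) - fderiv ℝ G (ψ p s) (Y s (q - p))
          = fderiv ℝ G (ψ p s) (ψ q s - ψ p s - Y s (q - p))
            + (G (ψ q s) - G (ψ p s) - fderiv ℝ G (ψ p s) (ψ q s - ψ p s)) := by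
        simp only [map_sub]; abel
      rw [h2]
      refine (norm_add_le _ _).trans (add_le_add ?_ (h1.trans ?_))
      · exact ((fderiv ℝ G (ψ p s)).le_opNorm _).trans
          (mul_le_mul_of_nonneg_right (hDG _) (norm_nonneg _))
      · rw [← dist_eq_norm, ← dist_eq_norm]
        exact mul_le_mul_of_nonneg_left hd hηpos.le) t ht
  -- With zero initial error the Grönwall bound is linear in the forcing; its formula is separate
  -- for `K = 0`.
  have hscale : gronwallBound 0 K (η * (C * ‖q - p‖)) (t - 0)
      = (η * (C * ‖q - p‖)) * gronwallBound 0 K 1 t := by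
    rw [sub_zero]
    by_cases hK0 : (K : ℝ) = 0
    · rw [hK0, gronwallBound_K0, gronwallBound_K0]; ring
    · rw [gronwallBound_of_K_ne_0 hK0, gronwallBound_of_K_ne_0 hK0]; ring
  have hmono : gronwallBound 0 K 1 t ≤ Γ :=
    gronwallBound_mono le_rfl zero_le_one K.2 ht.2
  rw [hscale] at hgr
  refine hgr.trans ?_
  calc η * (C * ‖q - p‖) * gronwallBound 0 K 1 t
      ≤ η * (C * ‖q - p‖) * (Γ + 1) := by gcongr; linarith
    _ = c * ‖q - p‖ := by rw [hη]; field_simp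

end Flow

/-! ### Uniqueness and regularity of the backup flow -/

/-- A map which is `C¹` on a neighbourhood of a compact set agrees near that set with a compactly
supported `C¹` map. -/
lemma exists_contDiff_hasCompactSupport_eqOn {P Q : Type*} [NormedAddCommGroup P]
    [NormedSpace ℝ P] [FiniteDimensional ℝ P] [NormedAddCommGroup Q] [NormedSpace ℝ Q]
    {G : P → Q} {k U : Set P} (hk : IsCompact k) (hU : IsOpen U) (hkU : k ⊆ U)
    (hG : ∀ y ∈ U, ContDiffAt ℝ 1 G y) :
    ∃ G' : P → Q, ContDiff ℝ 1 G' ∧ HasCompactSupport G' ∧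
      ∃ V, IsOpen V ∧ k ⊆ V ∧ V ⊆ U ∧ EqOn G' G V := by
  have : ProperSpace P := FiniteDimensional.proper ℝ P
  obtain ⟨δ, hδ, hδU⟩ := hk.exists_cthickening_subset_open hU hkU
  obtain ⟨χ, hχ, -, hsupp, hone⟩ := exists_contMDiff_support_eq_eq_one_iff (n := 1)
    (modelWithCornersSelf ℝ P)
    (s := Metric.thickening δ k) (t := Metric.cthickening (δ / 2) k) Metric.isOpen_thickening
    Metric.isClosed_cthickening (Metric.cthickening_subset_thickening' hδ (by linarith) k)
  have hχ' : ContDiff ℝ 1 χ := hχ.contDiff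
  have hts : tsupport χ ⊆ Metric.cthickening δ k := by
    rw [tsupport, hsupp]; exact Metric.closure_thickening_subset_cthickening _ _
  have hχc : HasCompactSupport χ :=
    (hk.cthickening).of_isClosed_subset (isClosed_tsupport χ) hts
  refine ⟨fun y => χ y • G y, ?_, hχc.smul_right, Metric.thickening (δ / 2) k,
    Metric.isOpen_thickening, Metric.self_subset_thickening (by linarith) k, ?_, ?_⟩
  · rw [contDiff_iff_contDiffAt]
    intro y
    by_cases hy : y ∈ tsupport χ
    · exact hχ'.contDiffAt.smul (hG y (hδU (hts hy)))
    · have h0 : (fun y => χ y • G y) =ᶠ[𝓝 y] fun _ => 0 := by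
        filter_upwards [notMem_tsupport_iff_eventuallyEq.1 hy] with z hz
        simp [hz]
      exact contDiffAt_const.congr_of_eventuallyEq h0
  · exact (Metric.thickening_subset_cthickening _ _).trans
      ((Metric.cthickening_mono (by linarith) k).trans hδU)
  · intro y hy
    have : χ y = 1 := (hone y).1 (Metric.thickening_subset_cthickening _ _ hy)
    simp [this]

lemma ContDiffAt.eventually_contDiffAt_one {E F : Type*} [NormedAddCommGroup E] [NormedSpace ℝ E]
    [NormedAddCommGroup F] [NormedSpace ℝ F] {φ : E → F} {z : E} (h : ContDiffAt ℝ 1 φ z) :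
    ∀ᶠ y in 𝓝 z, ContDiffAt ℝ 1 φ y :=
  h.eventually (by simp)

lemma isOpen_setOf_contDiffAt_one {E F : Type*} [NormedAddCommGroup E] [NormedSpace ℝ E]
    [NormedAddCommGroup F] [NormedSpace ℝ F] {φ : E → F} : IsOpen {y | ContDiffAt ℝ 1 φ y} :=
  isOpen_iff_eventually.2 fun _ hy => hy.eventually_contDiffAt_one

lemma IsArc.continuousOn {n : ℕ} {F : ℝ → Vec n → Vec n} {T : ℝ} {z : Vec n} {γ : ℝ → Vec n}
    (h : IsArc F T z γ) : ContinuousOn γ (Icc 0 T) :=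
  fun τ hτ => (h.2 τ hτ).continuousWithinAt

/-- Uniqueness of solutions running through points at which the vector field is `C¹`. -/
lemma IsArc.eqOn {n : ℕ} {fcl : Vec n → Vec n} {u : ℝ → Vec n} {T : ℝ} {z : Vec n}
    {γ γ' : ℝ → Vec n} (h : IsArc (fun τ y => fcl y + u τ) T z γ)
    (h' : IsArc (fun τ y => fcl y + u τ) T z γ')
    (hC : ∀ τ ∈ Icc 0 T, ContDiffAt ℝ 1 fcl (γ τ)) : EqOn γ' γ (Icc 0 T) := by
  rcases lt_or_ge T 0 with hT | hT
  · simp [Icc_eq_empty hT.not_ge]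
  -- The field is Lipschitz only near points of `γ`, so uniqueness is propagated by continuous
  -- induction: agreement is a closed condition and extends to the right by local uniqueness.
  have hclosed : IsClosed ({τ | γ' τ = γ τ} ∩ Icc 0 T) := by
    rw [inter_comm]
    have := (h'.continuousOn.prodMk h.continuousOn).preimage_isClosed_of_isClosed isClosed_Icc
      (isClosed_diagonal (X := Vec n))
    exact this
  have key := hclosed.Icc_subset_of_forall_mem_nhdsWithin (a := 0) (b := T)
    (by simp [h.1, h'.1]) ?_
  · exact fun τ hτ => key hτ
  rintro τ ⟨hτ, hτT⟩
  have hτ' := Ico_subset_Icc_self hτT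
  obtain ⟨K, t, ht, hK⟩ := (hC τ hτ').exists_lipschitzOnWith
  have hnear : ∀ g : ℝ → Vec n, ContinuousOn g (Icc 0 T) → g τ = γ τ →
      ∀ᶠ s in 𝓝[≥] τ, g s ∈ t := fun g hg hgτ => by
    have h1 : Tendsto g (𝓝[Icc 0 T] τ) (𝓝 (γ τ)) := hgτ ▸ hg τ hτ'
    have h2 : 𝓝[≥] τ ≤ 𝓝[Icc 0 T] τ :=
      nhdsWithin_le_of_mem (mem_of_superset (Icc_mem_nhdsGE hτT.2) (Icc_subset_Icc_left hτT.1))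
    exact (h1.mono_left h2) ht
  obtain ⟨b, hb, hbs⟩ : ∃ b ∈ Ioc τ T, Icc τ b ⊆ {s | γ s ∈ t ∧ γ' s ∈ t} := by
    obtain ⟨b, hb, hbs⟩ := mem_nhdsGE_iff_exists_Icc_subset.1
      ((hnear γ h.continuousOn rfl).and (hnear γ' h'.continuousOn hτ))
    exact ⟨min b T, ⟨lt_min hb hτT.2, min_le_right _ _⟩,
      (Icc_subset_Icc_right (min_le_left _ _)).trans hbs⟩
  have hsub : Icc τ b ⊆ Icc 0 T := Icc_subset_Icc hτT.1 hb.2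
  have hu := ODE_solution_unique_of_mem_Icc_right (v := fun τ y => fcl y + u τ) (s := fun _ => t)
    (K := K) (f := γ') (g := γ) (a := τ) (b := b)
    (fun s _ x hx y hy => by simpa using hK hx hy)
    (h'.continuousOn.mono hsub)
    (fun s hs => (h'.2 s (hsub (Ico_subset_Icc_self hs))).Ici_of_Icc
      ⟨hτT.1.trans hs.1, hs.2.trans_le hb.2⟩)
    (fun s hs => (hbs (Ico_subset_Icc_self hs)).2)
    (h.continuousOn.mono hsub)
    (fun s hs => (h.2 s (hsub (Ico_subset_Icc_self hs))).Ici_of_Icc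
      ⟨hτT.1.trans hs.1, hs.2.trans_le hb.2⟩)
    (fun s hs => (hbs (Ico_subset_Icc_self hs)).1) hτ
  exact mem_of_superset (Ioc_mem_nhdsGT hb.1) fun s hs => hu (Ioc_subset_Icc_self hs)

/-- The flow coincides with any solution running through points at which the field is `C¹`. -/
lemma IsArc.flow_eq {n : ℕ} {fcl : Vec n → Vec n} {u : ℝ → Vec n} {T : ℝ} {z : Vec n}
    {γ : ℝ → Vec n} (h : IsArc (fun τ y => fcl y + u τ) T z γ)
    (hC : ∀ τ ∈ Icc 0 T, ContDiffAt ℝ 1 fcl (γ τ)) {τ : ℝ} (hτ : τ ∈ Icc 0 T) :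
    flow (fun τ y => fcl y + u τ) T τ z = γ τ := by
  have H : ∃ γ : ℝ → Vec n, IsArc (fun τ y => fcl y + u τ) T z γ := ⟨γ, h⟩
  rw [flow, dif_pos H]
  exact h.eqOn (Classical.choose_spec H) hC hτ

lemma flow_zero {n : ℕ} (F : ℝ → Vec n → Vec n) (T : ℝ) (z : Vec n) : flow F T 0 z = z := by
  rw [flow]
  split_ifs with H
  · exact (Classical.choose_spec H).1
  · rfl

lemma estFlow_zero {n : ℕ} (fcl : Vec n → Vec n) (T : ℝ) (v z : Vec n) :
    estFlow fcl T v 0 z = z :=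
  flow_zero _ _ _

/-- Near an initial value and an estimate for which the backup flow runs through points at which
the vector field is `C¹`, the flow depends on both in a differentiable and Lipschitz way. -/
lemma estFlow_differentiableAt_and_lipschitz {n : ℕ} {fcl : Vec n → Vec n} {T : ℝ} {v z : Vec n}
    {γ : ℝ → Vec n} (h : IsArc (estField fcl v) T z γ)
    (hC : ∀ τ ∈ Icc 0 T, ContDiffAt ℝ 1 fcl (γ τ)) {τ : ℝ} (hτ : τ ∈ Icc 0 T) :
    DifferentiableAt ℝ (fun p : Vec n × Vec n => estFlow fcl T p.2 τ p.1) (z, v) ∧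
      ∃ K : ℝ≥0, ∃ N ∈ 𝓝 (z, v),
        LipschitzOnWith K (fun p : Vec n × Vec n => estFlow fcl T p.2 τ p.1) N := by
  have hT : 0 ≤ T := hτ.1.trans hτ.2
  set k : Set (Vec n × Vec n) := (fun s => (γ s, v)) '' Icc 0 T with hkdef
  have hk : IsCompact k :=
    isCompact_Icc.image_of_continuousOn (h.continuousOn.prodMk continuousOn_const)
  set U : Set (Vec n × Vec n) := {y | ContDiffAt ℝ 1 fcl y} ×ˢ univ with hUdef
  have hU : IsOpen U := isOpen_setOf_contDiffAt_one.prod isOpen_univ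
  have hkU : k ⊆ U := by
    rintro _ ⟨s, hs, rfl⟩
    exact ⟨hC s hs, mem_univ _⟩
  -- The estimate becomes a state component with zero velocity, which turns dependence on the
  -- parameter into dependence on the initial value.
  obtain ⟨G, hG, hGc, V, hV, hkV, hVU, hGV⟩ := exists_contDiff_hasCompactSupport_eqOn
    (G := fun p : Vec n × Vec n => (fcl p.1 + p.2, (0 : Vec n))) hk hU hkU
    (fun p hp => ((ContDiffAt.comp (g := fcl) (f := Prod.fst) p
      (show ContDiffAt ℝ 1 fcl p.1 from hp.1) contDiffAt_fst).add contDiffAt_snd).prodMk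
      contDiffAt_const)
  obtain ⟨K, hK⟩ := hG.lipschitzWith_of_hasCompactSupport hGc one_ne_zero
  obtain ⟨B, hB⟩ := hGc.exists_bound_of_continuous hG.continuous
  choose ψ hψ0 hψ using fun p : Vec n × Vec n =>
    exists_solution_of_bounded_lipschitz (F := fun _ => G) hT (K := K)
      (M := ⟨B, (norm_nonneg _).trans (hB 0)⟩) (fun _ _ => hK) (fun _ _ => hB)
      (fun _ => continuousOn_const) p
  have hbase : EqOn (ψ (z, v)) (fun s => (γ s, v)) (Icc 0 T) := by
    refine ODE_solution_unique (v := fun _ => G) (fun _ => hK)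
      (fun s hs => (hψ _ s hs).continuousWithinAt)
      (fun s hs => (hψ _ s (Ico_subset_Icc_self hs)).Ici_of_Icc hs)
      (h.continuousOn.prodMk continuousOn_const) (fun s hs => ?_) (by rw [hψ0, h.1])
    have hs' := Ico_subset_Icc_self hs
    have h1 := ((h.2 s hs').prodMk (hasDerivWithinAt_const s (Icc 0 T) v)).Ici_of_Icc hs
    rw [hGV (hkV (mem_image_of_mem _ hs'))]
    exact h1
  obtain ⟨r, hr, hrV⟩ := hk.exists_thickening_subset_open hV hkV
  -- Lipschitz dependence keeps nearby solutions where the cutoff is invisible, so they are genuine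
  -- backup arcs.
  have hev : ∀ᶠ p in 𝓝 (z, v), ∀ s ∈ Icc 0 T, ψ p s ∈ V := by
    have : ∀ᶠ p in 𝓝 (z, v), dist p (z, v) < r / Real.exp (K * T) :=
      Metric.ball_mem_nhds _ (by positivity)
    filter_upwards [this] with p hp s hs
    refine hrV (Metric.mem_thickening_iff.2 ⟨_, mem_image_of_mem _ hs, ?_⟩)
    have := dist_solution_le hK hψ0 hψ hs p (z, v)
    rw [hbase hs] at this
    exact this.trans_lt ((lt_div_iff₀' (Real.exp_pos _)).1 hp)
  have heq : ∀ᶠ p in 𝓝 (z, v), estFlow fcl T p.2 τ p.1 = (ψ p τ).1 := by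
    filter_upwards [hev] with p hp
    have hd : ∀ s ∈ Icc 0 T,
        HasDerivWithinAt (ψ p) (fcl (ψ p s).1 + (ψ p s).2, 0) (Icc 0 T) s := fun s hs => by
      have := hψ p s hs
      rwa [hGV (hp s hs)] at this
    have hsnd : ∀ s ∈ Icc 0 T, (ψ p s).2 = p.2 := fun s hs => by
      have := constant_of_has_deriv_right_zero (f := fun s => (ψ p s).2) (a := 0) (b := T)
        (fun s hs => (hd s hs).continuousWithinAt.snd)
        (fun s hs => ((ContinuousLinearMap.snd ℝ (Vec n) (Vec n)).hasFDerivAt.comp_hasDerivWithinAt s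
          (hd s (Ico_subset_Icc_self hs))).Ici_of_Icc hs) s hs
      rw [this, hψ0]
    have harc : IsArc (estField fcl p.2) T p.1 (fun s => (ψ p s).1) :=
      ⟨by simp only [hψ0], fun s hs => by
        have := (ContinuousLinearMap.fst ℝ (Vec n) (Vec n)).hasFDerivAt.comp_hasDerivWithinAt s
          (hd s hs)
        rw [hsnd s hs] at this
        exact this⟩
    exact harc.flow_eq (u := fun _ => p.2) (fun s hs => (hVU (hp s hs)).1) hτ
  refine ⟨?_, Real.toNNReal (Real.exp (K * T)), _, heq, ?_⟩
  · exact (differentiableAt_solution hG hGc hψ0 hψ hτ (z, v)).fst.congr_of_eventuallyEq heq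
  · refine LipschitzOnWith.of_dist_le_mul fun p hp q hq => ?_
    change _ = _ at hp hq
    simp only [hp, hq, Real.coe_toNNReal _ (Real.exp_pos _).le]
    exact (le_max_left _ _).trans (dist_solution_le hK hψ0 hψ hτ p q)

/-! ### Comparison and tangency -/

/-- A Lipschitz function which is nonnegative initially and has nonnegative derivative almost
everywhere where it is negative stays nonnegative. -/
lemma LipschitzOnWith.nonneg_of_ae_deriv_nonneg {H : ℝ → ℝ} {K : ℝ≥0} {a b : ℝ}
    (hH : LipschitzOnWith K H (Icc a b)) (ha : 0 ≤ H a)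
    (hd : ∀ᵐ t, t ∈ Ioo a b → H t < 0 → 0 ≤ deriv H t) : ∀ t ∈ Icc a b, 0 ≤ H t := by
  intro t ht
  by_contra! hneg
  have hcont := hH.continuousOn
  have hsub : Icc a t ⊆ Icc a b := Icc_subset_Icc_right ht.2
  set S : Set ℝ := Icc a t ∩ H ⁻¹' Ici 0 with hS
  have hScl : IsClosed S :=
    (hcont.mono hsub).preimage_isClosed_of_isClosed isClosed_Icc isClosed_Ici
  have hSne : S.Nonempty := ⟨a, left_mem_Icc.2 ht.1, ha⟩
  have hSbdd : BddAbove S := ⟨t, fun r hr => hr.1.2⟩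
  have hc : sSup S ∈ S := hScl.csSup_mem hSne hSbdd
  -- The last time up to `t` at which `H ≥ 0`. On `(c, t]` the function is negative, so integrating
  -- its derivative contradicts `H t < 0 ≤ H c`.
  set c := sSup S with hcdef
  have hct : c ≤ t := hc.1.2
  have hlt : ∀ r ∈ Ioc c t, H r < 0 := fun r hr => by
    by_contra! h0
    exact (le_csSup hSbdd ⟨⟨hc.1.1.trans hr.1.le, hr.2⟩, h0⟩).not_gt hr.1
  have hac : AbsolutelyContinuousOnInterval H c t :=
    (hH.mono (by rw [uIcc_of_le hct]; exact Icc_subset_Icc hc.1.1 ht.2)).absolutelyContinuousOnInterval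
  have hint := hac.integral_deriv_eq_sub
  have hpos : 0 ≤ ∫ r in c..t, deriv H r := by
    refine intervalIntegral.integral_nonneg_of_ae_restrict hct ?_
    rw [EventuallyLE, MeasureTheory.ae_restrict_iff' measurableSet_Icc]
    have hne : ∀ u : ℝ, ∀ᵐ r : ℝ, r ≠ u := fun u => by
      simp [MeasureTheory.ae_iff]
    filter_upwards [hd, hne c, hne t] with r hr hrc hrt hrm
    have h1 : c < r := lt_of_le_of_ne hrm.1 (Ne.symm hrc)
    have h2 : r < t := lt_of_le_of_ne hrm.2 hrt
    exact hr ⟨hc.1.1.trans_lt h1, h2.trans_le ht.2⟩ (hlt r ⟨h1, h2.le⟩)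
  have : (0 : ℝ) ≤ H c := hc.2
  linarith

/-- Tangency condition: if `e' ≤ ⟨∇h, W + d⟩` at the points with `h = e(t)`, where `∇h ≠ 0`, then
a trajectory of `x' = W(x) + d` starting in `{h ≥ e}` remains there for a short time. -/
lemma eventually_le_of_tangent {E : Type*} [NormedAddCommGroup E] [NormedSpace ℝ E]
    {h : E → ℝ} {W : E → E} {d x : ℝ → E} {e e' : ℝ → ℝ} {a b : ℝ} (hab : a < b)
    (hx : ∀ t ∈ Icc a b, HasDerivWithinAt x (W (x t) + d t) (Icc a b) t)
    (hh : ContDiffAt ℝ 1 h (x a)) (hgrad : fderiv ℝ h (x a) ≠ 0)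
    {L : ℝ≥0} {N : Set E} (hN : N ∈ 𝓝 (x a)) (hW : LipschitzOnWith L W N)
    (he : ∀ t ∈ Icc a b, HasDerivWithinAt e (e' t) (Icc a b) t) (ha : e a ≤ h (x a))
    (htan : ∀ t ∈ Icc a b, ∀ y ∈ N, h y = e t → e' t ≤ fderiv ℝ h y (W y + d t)) :
    ∀ᶠ t in 𝓝[>] a, e t ≤ h (x t) := by
  obtain ⟨v, hv⟩ : ∃ v, 0 < fderiv ℝ h (x a) v := by
    obtain ⟨w, hw⟩ : ∃ w, fderiv ℝ h (x a) w ≠ 0 := by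
      by_contra! hcon
      exact hgrad (ContinuousLinearMap.ext hcon)
    rcases lt_or_gt_of_ne hw with h1 | h1
    · exact ⟨-w, by simpa using h1⟩
    · exact ⟨w, h1⟩
  obtain ⟨c, hc, hcv⟩ := exists_between hv
  have hfc : ContinuousAt (fderiv ℝ h) (x a) :=
    (hh.fderiv_right (m := 0) (by norm_num)).continuousAt
  set M : ℝ := ‖fderiv ℝ h (x a)‖ + 1 with hM
  have hMpos : 0 < M := by positivity
  have hgood : ∀ᶠ y in 𝓝 (x a), ContDiffAt ℝ 1 h y ∧ c < fderiv ℝ h y v ∧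
      ‖fderiv ℝ h y‖ < M ∧ y ∈ N :=
    hh.eventually_contDiffAt_one.and (((hfc.clm_apply continuousAt_const).eventually_const_lt
      hcv).and ((hfc.norm.eventually_lt_const (lt_add_one _)).and hN))
  obtain ⟨R, hR, hball⟩ := Metric.eventually_nhds_iff_ball.1 hgood
  have hxc : ContinuousOn x (Icc a b) := fun t ht => (hx t ht).continuousWithinAt
  obtain ⟨b', hb', hnear⟩ : ∃ b' ∈ Ioc a b, ∀ t ∈ Icc a b', dist (x t) (x a) < R / 2 := by
    have h1 : Tendsto x (𝓝[≥] a) (𝓝 (x a)) := by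
      have := hxc a (left_mem_Icc.2 hab.le)
      rwa [ContinuousWithinAt, nhdsWithin_Icc_eq_nhdsGE hab] at this
    obtain ⟨u, hu, hus⟩ := mem_nhdsGE_iff_exists_Icc_subset.1
      (h1 (Metric.ball_mem_nhds (x a) (half_pos hR)))
    exact ⟨min u b, ⟨lt_min hu hab, min_le_right _ _⟩,
      fun t ht => hus ⟨ht.1, ht.2.trans (min_le_left _ _)⟩⟩
  -- Growth rate of the push along `v`: its gain in `h`, at least `K * c` per unit of push, must
  -- strictly exceed the loss `M * L * ‖v‖` from evaluating `W` at the unpushed point.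
  set K : ℝ := (M * L * ‖v‖ + 1) / c with hK
  have hK0 : 0 < K := by positivity
  have hKc : M * L * ‖v‖ < K * c := by rw [hK, div_mul_cancel₀ _ hc.ne']; linarith
  set A : ℝ := Real.exp (K * (b' - a)) with hA
  have hsub : Icc a b' ⊆ Icc a b := Icc_subset_Icc_right hb'.2
  have hsmall : ∀ᶠ κ in 𝓝[>] (0 : ℝ), κ * A * ‖v‖ < R / 2 := by
    have : Tendsto (fun κ : ℝ => κ * A * ‖v‖) (𝓝 0) (𝓝 (0 * A * ‖v‖)) :=
      Continuous.tendsto (by fun_prop) 0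
    rw [zero_mul, zero_mul] at this
    exact nhdsWithin_le_nhds (this.eventually_lt_const (half_pos hR))
  have hstart : ∀ᶠ κ in 𝓝[>] (0 : ℝ), h (x a) ≤ h (x a + κ • v) := by
    have hline : HasDerivAt (fun κ : ℝ => x a + κ • v) v 0 := by
      simpa using! ((hasDerivAt_id (0 : ℝ)).smul_const v).const_add (x a)
    have hd : HasDerivAt (fun κ : ℝ => h (x a + κ • v)) (fderiv ℝ h (x a) v) 0 := by
      refine HasFDerivAt.comp_hasDerivAt (𝕜 := ℝ) (l := h) (f := fun κ : ℝ => x a + κ • v) 0 ?_ hline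
      simpa using! (hh.differentiableAt one_ne_zero).hasFDerivAt
    have hs := (hasDerivAt_iff_tendsto_slope.1 hd).mono_left
      (nhdsWithin_mono (0 : ℝ) (fun y (hy : y ∈ Ioi (0 : ℝ)) => hy.ne'))
    filter_upwards [hs.eventually_const_lt hv, self_mem_nhdsWithin] with κ h1 h2
    rw [slope_def_field, sub_zero] at h1
    have := (div_pos_iff_of_pos_right (show (0 : ℝ) < κ from h2)).1 h1
    simp only [zero_smul, add_zero] at this
    linarith
  -- The weak tangency inequality is no strict barrier for `x` itself. An exponentially growing push
  -- makes it strict at every contact time; the claim follows as `κ → 0`.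
  have key : ∀ᶠ κ in 𝓝[>] (0 : ℝ), ∀ t ∈ Icc a b',
      e t ≤ h (x t + (κ * Real.exp (K * (t - a))) • v) := by
    filter_upwards [hsmall, hstart, self_mem_nhdsWithin] with κ h1 h2 hκ
    have hκ : 0 < κ := hκ
    set r : ℝ → ℝ := fun t => κ * Real.exp (K * (t - a)) with hr
    have hrpos : ∀ t, 0 < r t := fun t => by positivity
    have hrd : ∀ t, HasDerivAt r (K * r t) t := fun t => by
      have h3 : HasDerivAt (fun t : ℝ => K * (t - a)) K t := by
        simpa using! ((hasDerivAt_id t).sub_const a).const_mul K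
      have := (h3.exp).const_mul κ
      convert! this using 1
      simp only [hr]; ring
    have hmem : ∀ t ∈ Icc a b', x t + r t • v ∈ Metric.ball (x a) R := fun t ht => by
      have h3 : r t ≤ κ * A := by
        simp only [hr, hA]
        gcongr
        exact ht.2
      have h4 : ‖r t • v‖ < R / 2 := by
        rw [norm_smul, Real.norm_eq_abs, abs_of_pos (hrpos t)]
        exact (mul_le_mul_of_nonneg_right h3 (norm_nonneg v)).trans_lt h1
      have h5 := hnear t ht
      rw [Metric.mem_ball, dist_eq_norm] at *
      calc ‖x t + r t • v - x a‖ = ‖(x t - x a) + r t • v‖ := by congr 1; abel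
        _ ≤ ‖x t - x a‖ + ‖r t • v‖ := norm_add_le _ _
        _ < R := by linarith
    have hyd : ∀ t ∈ Icc a b', HasDerivWithinAt (fun t => x t + r t • v)
        (W (x t) + d t + (K * r t) • v) (Icc a b') t := fun t ht =>
      ((hx t (hsub ht)).mono hsub).add ((hrd t).smul_const v).hasDerivWithinAt
    have hBd : ∀ t ∈ Icc a b', HasDerivWithinAt (fun t => h (x t + r t • v))
        (fderiv ℝ h (x t + r t • v) (W (x t) + d t + (K * r t) • v)) (Icc a b') t := fun t ht =>
      HasFDerivAt.comp_hasDerivWithinAt (𝕜 := ℝ) (l := h) (f := fun t => x t + r t • v) t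
        (((hball _ (hmem t ht)).1.differentiableAt one_ne_zero).hasFDerivAt) (hyd t ht)
    refine image_le_of_deriv_right_lt_deriv_boundary' (f := e) (f' := e')
      (B := fun t => h (x t + r t • v))
      (fun t ht => ((he t (hsub ht)).mono hsub).continuousWithinAt)
      (fun t ht => ((he t (hsub (Ico_subset_Icc_self ht))).mono hsub).Ici_of_Icc ht)
      ?_ (fun t ht => (hBd t ht).continuousWithinAt)
      (fun t ht => (hBd t (Ico_subset_Icc_self ht)).Ici_of_Icc ht) ?_
    · simp only [hr, sub_self, mul_zero, Real.exp_zero, mul_one]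
      exact ha.trans h2
    · intro t ht heq
      have ht' := Ico_subset_Icc_self ht
      obtain ⟨-, g2, g3, g4⟩ := hball _ (hmem t ht')
      have hxN : x t ∈ N := (hball _ (Metric.mem_ball.2 ((hnear t ht').trans (by linarith)))).2.2.2
      have h3 := htan t (hsub ht') _ g4 heq.symm
      set y := x t + r t • v with hy
      -- The tangency hypothesis concerns the field at the contact point `y`, whereas the curve
      -- moves with the field at `x t`.
      have h4 : W (x t) + d t + (K * r t) • v = (W y + d t) - (W y - W (x t)) + (K * r t) • v := by
        abel
      have h5 : ‖W y - W (x t)‖ ≤ L * (r t * ‖v‖) := by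
        have := hW.dist_le_mul _ g4 _ hxN
        rw [dist_eq_norm, dist_eq_norm] at this
        have h6 : ‖y - x t‖ = r t * ‖v‖ := by
          rw [hy, add_sub_cancel_left, norm_smul, Real.norm_eq_abs, abs_of_pos (hrpos t)]
        rwa [h6] at this
      have h6 : fderiv ℝ h y (W y - W (x t)) ≤ M * (L * (r t * ‖v‖)) :=
        (le_abs_self _).trans (((fderiv ℝ h y).le_opNorm _).trans
          (mul_le_mul g3.le h5 (norm_nonneg _) hMpos.le))
      rw [h4, map_add, map_sub, map_smul, smul_eq_mul]
      have h7 : M * (L * (r t * ‖v‖)) < K * r t * c := by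
        nlinarith [hrpos t]
      have h8 : K * r t * c ≤ K * r t * fderiv ℝ h y v :=
        mul_le_mul_of_nonneg_left g2.le (mul_pos hK0 (hrpos t)).le
      linarith
  filter_upwards [Ioc_mem_nhdsGT hb'.1] with t ht
  have ht' := Ioc_subset_Icc_self ht
  have hcont : ContinuousAt h (x t) :=
    (hball _ (Metric.mem_ball.2 ((hnear t ht').trans (by linarith)))).1.continuousAt
  have hlim : Tendsto (fun κ : ℝ => h (x t + (κ * Real.exp (K * (t - a))) • v)) (𝓝[>] 0)
      (𝓝 (h (x t))) := by
    have h1 : Tendsto (fun κ : ℝ => x t + (κ * Real.exp (K * (t - a))) • v) (𝓝 0) (𝓝 (x t)) :=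
      Continuous.tendsto' (by fun_prop) _ _ (by simp)
    exact (hcont.tendsto.comp h1).mono_left nhdsWithin_le_nhds
  exact ge_of_tendsto hlim (key.mono fun κ hκ => hκ t ht')

/-! ### Locally Lipschitz calculus -/

/-- A locally Lipschitz map composed with a locally Lipschitz map. -/
lemma LocallyLipschitzOn.comp_of_mapsTo {α β γ : Type*} [PseudoEMetricSpace α]
    [PseudoEMetricSpace β] [PseudoEMetricSpace γ] {F : β → γ} {g : α → β} {s : Set α} {t : Set β}
    (hF : LocallyLipschitzOn t F) (hg : LocallyLipschitzOn s g) (hm : MapsTo g s t) :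
    LocallyLipschitzOn s (F ∘ g) := by
  intro a ha
  obtain ⟨K, u, hu, hK⟩ := hF (hm ha)
  obtain ⟨K', u', hu', hK'⟩ := hg ha
  have h1 : g ⁻¹' u ∈ 𝓝[s] a := (hg.continuousOn a ha).tendsto_nhdsWithin hm hu
  exact ⟨K * K', u' ∩ g ⁻¹' u, inter_mem hu' h1,
    hK.comp (hK'.mono inter_subset_left) fun z hz => hz.2⟩

lemma LocallyLipschitzOn.prodMk {α β γ : Type*} [PseudoEMetricSpace α]
    [PseudoEMetricSpace β] [PseudoEMetricSpace γ] {F : α → β} {g : α → γ} {s : Set α}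
    (hF : LocallyLipschitzOn s F) (hg : LocallyLipschitzOn s g) :
    LocallyLipschitzOn s (fun a => (F a, g a)) := by
  intro a ha
  obtain ⟨K, u, hu, hK⟩ := hF ha
  obtain ⟨K', u', hu', hK'⟩ := hg ha
  exact ⟨max K K', u ∩ u', inter_mem hu hu',
    (hK.mono inter_subset_left).prodMk (hK'.mono inter_subset_right)⟩

lemma C1On.locallyLipschitzOn {E F : Type*} [NormedAddCommGroup E] [NormedSpace ℝ E]
    [NormedAddCommGroup F] [NormedSpace ℝ F] {S : Set E} {φ : E → F} (h : C1On S φ) :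
    LocallyLipschitzOn S φ := fun z hz => by
  obtain ⟨K, t, ht, hK⟩ := (h z hz).exists_lipschitzOnWith
  exact ⟨K, t, mem_nhdsWithin_of_mem_nhds ht, hK⟩

lemma C1On.continuousOn {E F : Type*} [NormedAddCommGroup E] [NormedSpace ℝ E]
    [NormedAddCommGroup F] [NormedSpace ℝ F] {S : Set E} {φ : E → F} (h : C1On S φ) :
    ContinuousOn φ S := fun z hz => (h z hz).continuousAt.continuousWithinAt

/-- A curve with continuous velocity on a compact interval is Lipschitz. -/
lemma exists_lipschitzOnWith_of_continuousOn_deriv {E : Type*} [NormedAddCommGroup E]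
    [NormedSpace ℝ E] {x x' : ℝ → E} {a b : ℝ}
    (hx : ∀ t ∈ Icc a b, HasDerivWithinAt x (x' t) (Icc a b) t) (hc : ContinuousOn x' (Icc a b)) :
    ∃ K, LipschitzOnWith K x (Icc a b) := by
  obtain ⟨M, hM⟩ := isCompact_Icc.exists_bound_of_continuousOn hc
  exact ⟨M.toNNReal, (convex_Icc a b).lipschitzOnWith_of_nnnorm_hasDerivWithin_le hx
    fun t ht => by rw [← norm_toNNReal]; exact Real.toNNReal_le_toNNReal (hM t ht)⟩

lemma C1On.backupField {n m : ℕ} {X : Set (Vec n)} {f : Vec n → Vec n}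
    {g : Vec n → Vec m →L[ℝ] Vec n} {kb : Vec n → Vec m} (hf : C1On X f) (hg : C1On X g)
    (hkb : C1On X kb) : C1On X (backupField f g kb) := fun z hz =>
  (hf z hz).add ((hg z hz).clm_apply (hkb z hz))

lemma LipschitzOnWith.ae_differentiableAt_of_mem_Ioo {n : ℕ} {v : ℝ → Vec n} {K : ℝ≥0} {a b : ℝ}
    (hv : LipschitzOnWith K v (Icc a b)) : ∀ᵐ t, t ∈ Ioo a b → DifferentiableAt ℝ v t := by
  filter_upwards [hv.ae_differentiableWithinAt_of_mem_real] with t ht htm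
  exact (ht (Ioo_subset_Icc_self htm)).differentiableAt (Icc_mem_nhds htm.1 htm.2)

/-! ### The barrier argument and the closed loop -/

/-- The total derivative of the estimate flow along a trajectory of initial values and
estimates. -/
lemma hasDerivAt_estFlow_comp {n : ℕ} {fcl : Vec n → Vec n} {T τ t : ℝ} {x v : ℝ → Vec n}
    {x' v' : Vec n}
    (hd : DifferentiableAt ℝ (fun p : Vec n × Vec n => estFlow fcl T p.2 τ p.1) (x t, v t))
    (hx : HasDerivAt x x' t) (hv : HasDerivAt v v' t) :
    HasDerivAt (fun s => estFlow fcl T (v s) τ (x s))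
      (stateSens fcl T (v t) τ (x t) x' + estSens fcl T (v t) τ (x t) v') t := by
  -- Both sensitivities are restrictions of one joint derivative; the partial derivatives alone
  -- would not justify the chain rule.
  set D := fderiv ℝ (fun p : Vec n × Vec n => estFlow fcl T p.2 τ p.1) (x t, v t) with hD
  have hΦ : stateSens fcl T (v t) τ (x t) = D.comp (ContinuousLinearMap.inl ℝ _ _) :=
    (HasFDerivAt.comp (𝕜 := ℝ) (g := fun p : Vec n × Vec n => estFlow fcl T p.2 τ p.1)
      (f := fun z => (z, v t)) (x t) hd.hasFDerivAt (hasFDerivAt_prodMk_left _ _)).fderiv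
  have hΘ : estSens fcl T (v t) τ (x t) = D.comp (ContinuousLinearMap.inr ℝ _ _) :=
    (HasFDerivAt.comp (𝕜 := ℝ) (g := fun p : Vec n × Vec n => estFlow fcl T p.2 τ p.1)
      (f := fun w => (x t, w)) (v t) hd.hasFDerivAt (hasFDerivAt_prodMk_right _ _)).fderiv
  have h1 := HasFDerivAt.comp_hasDerivAt (𝕜 := ℝ)
    (l := fun p : Vec n × Vec n => estFlow fcl T p.2 τ p.1) (f := fun s => (x s, v s)) t
    hd.hasFDerivAt (hx.prodMk hv)
  have h2 : stateSens fcl T (v t) τ (x t) x' + estSens fcl T (v t) τ (x t) v' = D (x', v') := by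
    rw [hΦ, hΘ]
    simp only [ContinuousLinearMap.comp_apply, ContinuousLinearMap.inl_apply,
      ContinuousLinearMap.inr_apply, ← map_add, Prod.mk_add_mk, add_zero, zero_add]
  rw [h2]
  exact h1

/-- A barrier inequality along the trajectory, valid wherever the estimate is differentiable,
keeps a tightened constraint on the estimate flow satisfied. -/
lemma le_estFlow_of_barrier {n : ℕ} {X : Set (Vec n)} {η : Vec n → ℝ} (hη : C1On X η)
    {fcl : Vec n → Vec n} (hfcl : C1On X fcl) {T τ : ℝ} (hτ : τ ∈ Icc 0 T) {x v : ℝ → Vec n}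
    {a b : ℝ} (hx : LocallyLipschitzOn (Icc a b) x) (hv : LocallyLipschitzOn (Icc a b) v)
    (harc : ∀ t ∈ Icc a b, ∃ γ, IsArc (estField fcl (v t)) T (x t) γ ∧ MapsTo γ (Icc 0 T) X)
    {e : ℝ → ℝ} (he : C1On (Icc a b) e) {x' : ℝ → Vec n}
    (hx' : ∀ t ∈ Ioo a b, HasDerivAt x (x' t) t) {β : ℝ → ℝ} (hβ : IsClassKInfty β)
    (hineq : ∀ t ∈ Ioo a b, ∀ w, HasDerivAt v w t →
      -β (η (estFlow fcl T (v t) τ (x t)) - e t) + deriv e t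
        ≤ fderiv ℝ η (estFlow fcl T (v t) τ (x t))
            (stateSens fcl T (v t) τ (x t) (x' t) + estSens fcl T (v t) τ (x t) w))
    (h0 : e a ≤ η (estFlow fcl T (v a) τ (x a))) :
    ∀ t ∈ Icc a b, e t ≤ η (estFlow fcl T (v t) τ (x t)) := by
  have hreg := fun t (ht : t ∈ Icc a b) =>
    let ⟨_, hγ, hX⟩ := harc t ht
    estFlow_differentiableAt_and_lipschitz hγ (fun σ hσ => hfcl _ (hX hσ)) hτ
  have hmem : ∀ t ∈ Icc a b, estFlow fcl T (v t) τ (x t) ∈ X := fun t ht => by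
    obtain ⟨γ, hγ, hX⟩ := harc t ht
    have := hγ.flow_eq (u := fun _ => v t) (fun σ hσ => hfcl _ (hX hσ)) hτ
    rw [show estFlow fcl T (v t) τ (x t) = γ τ from this]
    exact hX hτ
  have hflow : LocallyLipschitzOn (Icc a b) (fun t => estFlow fcl T (v t) τ (x t)) := by
    have hpair : LocallyLipschitzOn (Icc a b) (fun t => (x t, v t)) := hx.prodMk hv
    have hjoint : LocallyLipschitzOn ((fun t => (x t, v t)) '' Icc a b)
        (fun p : Vec n × Vec n => estFlow fcl T p.2 τ p.1) := by
      rintro _ ⟨t, ht, rfl⟩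
      obtain ⟨K, N, hN, hK⟩ := (hreg t ht).2
      exact ⟨K, N, mem_nhdsWithin_of_mem_nhds hN, hK⟩
    exact LocallyLipschitzOn.comp_of_mapsTo (g := fun t => (x t, v t))
      (F := fun p : Vec n × Vec n => estFlow fcl T p.2 τ p.1) hjoint hpair (mapsTo_image _ _)
  have hloc : LocallyLipschitzOn (Icc a b)
      (fun t => η (estFlow fcl T (v t) τ (x t)) - e t) := by
    have h1 : LocallyLipschitzOn (Icc a b) (fun t => η (estFlow fcl T (v t) τ (x t))) :=
      LocallyLipschitzOn.comp_of_mapsTo (F := η) hη.locallyLipschitzOn hflow hmem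
    exact h1.sub he.locallyLipschitzOn
  obtain ⟨K, hK⟩ := hloc.exists_lipschitzOnWith_of_compact isCompact_Icc
  obtain ⟨Kv, hKv⟩ := hv.exists_lipschitzOnWith_of_compact isCompact_Icc
  refine fun t ht => sub_nonneg.1 (hK.nonneg_of_ae_deriv_nonneg (sub_nonneg.2 h0) ?_ t ht)
  filter_upwards [hKv.ae_differentiableAt_of_mem_Ioo] with t hdv htm hneg
  have htm' := Ioo_subset_Icc_self htm
  have hw := (hdv htm).hasDerivAt
  have h1 := hasDerivAt_estFlow_comp (hreg t htm').1 (hx' t htm) hw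
  have h2 := HasFDerivAt.comp_hasDerivAt (𝕜 := ℝ) (l := η)
    (f := fun t => estFlow fcl T (v t) τ (x t)) t
    ((hη _ (hmem t htm')).differentiableAt one_ne_zero).hasFDerivAt h1
  have h3 := h2.sub ((he t htm').differentiableAt one_ne_zero).hasDerivAt
  have h4 := hineq t htm _ hw
  have h5 : β (η (estFlow fcl T (v t) τ (x t)) - e t) < 0 := by
    rw [← hβ.map_zero]; exact hβ.strictMono hneg
  rw [show deriv (fun t => η (estFlow fcl T (v t) τ (x t)) - e t) t = _ from h3.deriv]
  linarith

/-- An inequality between continuous functions on `[a, b]` that holds where a Lipschitz function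
is differentiable holds on all of `[a, b]`. -/
lemma nonneg_of_nonneg_of_differentiableAt {n : ℕ} {v : ℝ → Vec n} {K : ℝ≥0} {a b : ℝ}
    (hab : a < b) (hv : LipschitzOnWith K v (Icc a b)) {φ : ℝ → ℝ}
    (hφ : ContinuousOn φ (Icc a b))
    (h : ∀ t ∈ Ioo a b, DifferentiableAt ℝ v t → 0 ≤ φ t) : ∀ t ∈ Icc a b, 0 ≤ φ t := by
  -- A set of full measure is dense, and a closed inequality between continuous functions passes to
  -- the closure.
  have hd : Dense {t | t ∈ Ioo a b → DifferentiableAt ℝ v t} :=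
    MeasureTheory.Measure.dense_of_ae hv.ae_differentiableAt_of_mem_Ioo
  intro t ht
  have hcl : t ∈ closure (Ioo a b ∩ {t | t ∈ Ioo a b → DifferentiableAt ℝ v t}) := by
    have h1 := hd.open_subset_closure_inter (isOpen_Ioo (a := a) (b := b))
    have h2 := closure_minimal h1 isClosed_closure
    rw [closure_Ioo hab.ne] at h2
    exact h2 ht
  have hc : ContinuousWithinAt φ (Ioo a b ∩ {t | t ∈ Ioo a b → DifferentiableAt ℝ v t}) t :=
    (hφ t ht).mono (inter_subset_left.trans Ioo_subset_Icc_self)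
  have hr := hc.mem_closure (t := Ici 0) hcl fun s hs => h s hs.1 (hs.2 hs.1)
  rwa [isClosed_Ici.closure_eq] at hr

/-- At `τ = 0` the flow returns its initial value whatever the estimate, so the constraint there
reduces to a condition on `h` and the closed-loop field alone. -/
lemma stateSens_zero {n : ℕ} (fcl : Vec n → Vec n) (T : ℝ) (v z : Vec n) :
    stateSens fcl T v 0 z = ContinuousLinearMap.id ℝ (Vec n) := by
  simp only [stateSens, estFlow_zero, fderiv_fun_id]

lemma estSens_zero {n : ℕ} (fcl : Vec n → Vec n) (T : ℝ) (v z : Vec n) :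
    estSens fcl T v 0 z = 0 := by
  simp only [estSens, estFlow_zero, fderiv_fun_const, Pi.zero_apply]

lemma ContDiffAt.continuousAt_deriv_one {e : ℝ → ℝ} {t : ℝ} (he : ContDiffAt ℝ 1 e t) :
    ContinuousAt (deriv e) t := by
  have h1 : ContinuousAt (fun s => fderiv ℝ e s 1) t :=
    (he.fderiv_right (m := 0) (by norm_num)).continuousAt.clm_apply continuousAt_const
  simpa only [fderiv_apply_one_eq_deriv] using h1

/-- The closed-loop vector field under a locally Lipschitz controller is locally Lipschitz. -/
lemma locallyLipschitzOn_closedLoop {n m : ℕ} {X : Set (Vec n)} {f : Vec n → Vec n}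
    (hf : C1On X f) {g : Vec n → Vec m →L[ℝ] Vec n} (hg : C1On X g) {k : Vec n → Vec m}
    (hk : LocallyLipschitzOn X k) : LocallyLipschitzOn X (fun z => f z + g z (k z)) := by
  have hev : LocallyLipschitzOn univ (fun p : (Vec m →L[ℝ] Vec n) × Vec m => p.1 p.2) :=
    C1On.locallyLipschitzOn fun p _ => isBoundedBilinearMap_apply.contDiff.contDiffAt
  have hpair : LocallyLipschitzOn X (fun z => (g z, k z)) := hg.locallyLipschitzOn.prodMk hk
  have hgk : LocallyLipschitzOn X (fun z => g z (k z)) :=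
    LocallyLipschitzOn.comp_of_mapsTo (F := fun p : (Vec m →L[ℝ] Vec n) × Vec m => p.1 p.2)
      (g := fun z => (g z, k z)) hev hpair (mapsTo_univ _ _)
  exact hf.locallyLipschitzOn.add hgk

section ClosedLoop

variable {n m : ℕ} {X : Set (Vec n)} {U : Set (Vec m)} {f : Vec n → Vec n}
  {g : Vec n → Vec m →L[ℝ] Vec n} {d : ℝ → Vec n} {p q : ℝ × Vec n × Vec m × Vec n → Vec n}
  {k : Vec n → Vec m} {t₀ t₁ : ℝ} {x ξ : ℝ → Vec n}

/-- Trajectories and estimates of the closed loop are locally Lipschitz in time. -/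
lemma IsClosedLoopSolution.locallyLipschitzOn (hf : C1On X f) (hg : C1On X g)
    (hd : C1On (Ici 0) d) (hp : C1On (Ici 0 ×ˢ X ×ˢ U ×ˢ univ) p)
    (hq : C1On (Ici 0 ×ˢ X ×ˢ U ×ˢ univ) q) (hk : LocallyLipschitzOn X k) (hkU : MapsTo k X U)
    (ht₀ : 0 ≤ t₀) (hsol : IsClosedLoopSolution X f g d p k t₀ t₁ x ξ) :
    LocallyLipschitzOn (Icc t₀ t₁) x ∧ LocallyLipschitzOn (Icc t₀ t₁) (estimate q k x ξ) := by
  have hxX : MapsTo x (Icc t₀ t₁) X := fun t ht => (hsol t ht).1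
  have hpos : Icc t₀ t₁ ⊆ Ici 0 := fun t ht => ht₀.trans ht.1
  have hxc : ContinuousOn x (Icc t₀ t₁) := fun t ht => (hsol t ht).2.1.continuousWithinAt
  have hξc : ContinuousOn ξ (Icc t₀ t₁) := fun t ht => (hsol t ht).2.2.continuousWithinAt
  have hmaps : MapsTo (fun t => (t, x t, k (x t), ξ t)) (Icc t₀ t₁)
      (Ici 0 ×ˢ X ×ˢ U ×ˢ univ) :=
    fun t ht => ⟨hpos ht, hxX ht, hkU (hxX ht), mem_univ _⟩
  have hkx := hk.continuousOn.comp hxc hxX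
  have hx : LocallyLipschitzOn (Icc t₀ t₁) x := by
    obtain ⟨K, hK⟩ := exists_lipschitzOnWith_of_continuousOn_deriv
      (fun t ht => (hsol t ht).2.1)
      (((hf.continuousOn.comp hxc hxX).add ((hg.continuousOn.comp hxc hxX).clm_apply hkx)).add
        (hd.continuousOn.mono hpos))
    exact fun t ht => ⟨K, _, self_mem_nhdsWithin, hK⟩
  have hξ : LocallyLipschitzOn (Icc t₀ t₁) ξ := by
    obtain ⟨K, hK⟩ := exists_lipschitzOnWith_of_continuousOn_deriv
      (fun t ht => (hsol t ht).2.2)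
      (hp.continuousOn.comp (continuousOn_id.prodMk (hxc.prodMk (hkx.prodMk hξc))) hmaps)
    exact fun t ht => ⟨K, _, self_mem_nhdsWithin, hK⟩
  have hid : LocallyLipschitzOn (Icc t₀ t₁) (fun t : ℝ => t) :=
    LocallyLipschitz.id.locallyLipschitzOn
  have hkx' : LocallyLipschitzOn (Icc t₀ t₁) (fun t => k (x t)) :=
    LocallyLipschitzOn.comp_of_mapsTo (F := k) hk hx hxX
  have hargs : LocallyLipschitzOn (Icc t₀ t₁) (fun t => (t, x t, k (x t), ξ t)) :=
    hid.prodMk (hx.prodMk (hkx'.prodMk hξ))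
  exact ⟨hx, LocallyLipschitzOn.comp_of_mapsTo (F := q) (g := fun t => (t, x t, k (x t), ξ t))
    hq.locallyLipschitzOn hargs hmaps⟩

end ClosedLoop

/-! ### The main theorem -/

theorem theorem3 {n m : ℕ}
    -- state set, input set, dynamics, disturbance
    (X : Set (Vec n)) (U : Set (Vec m))
    (f : Vec n → Vec n) (hf : C1On X f)
    (g : Vec n → Vec m →L[ℝ] Vec n) (hg : C1On X g)
    (d : ℝ → Vec n) (hd : C1On (Ici 0) d)
    -- safe set function, backup set function, backup controller, horizon
    (h : Vec n → ℝ) (hh : C1On X h)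
    (hgrad : ∀ x ∈ frontier (safeSet X h), h x = 0 → fderiv ℝ h x ≠ 0)
    (hb : Vec n → ℝ) (hhb : C1On X hb)
    (kb : Vec n → Vec m) (hkb : C1On X kb) (hkbU : MapsTo kb X U)
    (T : ℝ) (hT : 0 < T)
    -- uncertainty estimator
    (p q : ℝ × Vec n × Vec m × Vec n → Vec n)
    (hp : C1On (Ici 0 ×ˢ X ×ˢ U ×ˢ univ) p) (hq : C1On (Ici 0 ×ˢ X ×ˢ U ×ˢ univ) q)
    -- controller
    (k : Vec n → Vec m) (hk : LocallyLipschitzOn X k) (hkU : MapsTo k X U)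
    -- a trajectory of the closed loop, meeting the zero level of `h` only at interior points of `X`
    (t₀ t₁ : ℝ) (ht₀ : 0 ≤ t₀) (x ξ : ℝ → Vec n)
    (hsol : IsClosedLoopSolution X f g d p k t₀ t₁ x ξ)
    (hint : ∀ t ∈ Icc t₀ t₁, h (x t) = 0 → x t ∈ interior X)
    -- the backup flows from the safe set exist on the horizon and stay in `X`
    (hest : ∀ t ∈ Icc t₀ t₁, ∀ z ∈ safeSet X h, ∃ γ,
      IsArc (estField (backupField f g kb) (estimate q k x ξ t)) T z γ ∧ MapsTo γ (Icc 0 T) X)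
    (hdist : ∀ t ∈ Icc t₀ t₁, ∀ z ∈ safeSet X h, ∃ γ,
      IsArc (distField (backupField f g kb) d t) T z γ ∧ MapsTo γ (Icc 0 T) X)
    -- flow deviation bound and tightening terms
    (Lh Lhb : ℝ≥0) (hLh : LipschitzOnWith Lh h X) (hLhb : LipschitzOnWith Lhb hb X)
    (δmax : ℝ → ℝ → ℝ) (hδ0 : ∀ τ ∈ Icc 0 T, ∀ t ∈ Icc t₀ t₁, 0 ≤ δmax τ t)
    (hδ : ∀ τ ∈ Icc 0 T, ∀ t ∈ Icc t₀ t₁, ∀ z ∈ safeSet X h,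
      ‖distFlow (backupField f g kb) T d t τ z
        - estFlow (backupField f g kb) T (estimate q k x ξ t) τ z‖ ≤ δmax τ t)
    (ε : ℝ → ℝ → ℝ) (εb : ℝ → ℝ)
    (hεC1 : ∀ τ ∈ Icc 0 T, C1On (Ici 0) (ε τ)) (hεbC1 : C1On (Ici 0) εb)
    (hε : ∀ τ ∈ Icc 0 T, ∀ t ∈ Icc t₀ t₁, Lh * δmax τ t ≤ ε τ t)
    (hεb : ∀ t ∈ Icc t₀ t₁, Lhb * δmax T t ≤ εb t)
    -- class-K∞ functions and robustness terms
    (α αb : ℝ → ℝ) (hα : IsClassKInfty α) (hαb : IsClassKInfty αb)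
    (ρ : ℝ → ℝ → Vec n → ℝ) (ρb : ℝ → Vec n → ℝ)
    (hρ : ∀ τ ∈ Icc 0 T, ∀ t ∈ Ioo t₀ t₁, ∀ z ∈ safeSet X h, ∀ w : Vec n,
      HasDerivAt (estimate q k x ξ) w t →
      -(fderiv ℝ h (estFlow (backupField f g kb) T (estimate q k x ξ t) τ z)
          (stateSens (backupField f g kb) T (estimate q k x ξ t) τ z (d t - estimate q k x ξ t)
            + estSens (backupField f g kb) T (estimate q k x ξ t) τ z w)) ≤ ρ τ t z)
    (hρb : ∀ t ∈ Ioo t₀ t₁, ∀ z ∈ safeSet X h, ∀ w : Vec n,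
      HasDerivAt (estimate q k x ξ) w t →
      -(fderiv ℝ hb (estFlow (backupField f g kb) T (estimate q k x ξ t) T z)
          (stateSens (backupField f g kb) T (estimate q k x ξ t) T z (d t - estimate q k x ξ t)
            + estSens (backupField f g kb) T (estimate q k x ξ t) T z w)) ≤ ρb t z)
    -- the constraints satisfied by the controller
    (hcon : ∀ τ ∈ Icc 0 T, ∀ t ∈ Icc t₀ t₁, ∀ z ∈ safeSet X h,
      -α (h (estFlow (backupField f g kb) T (estimate q k x ξ t) τ z) - ε τ t)
          + deriv (ε τ) t + ρ τ t z
        ≤ fderiv ℝ h (estFlow (backupField f g kb) T (estimate q k x ξ t) τ z)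
            (stateSens (backupField f g kb) T (estimate q k x ξ t) τ z
              (f z + g z (k z) + estimate q k x ξ t)))
    (hconb : ∀ t ∈ Icc t₀ t₁, ∀ z ∈ safeSet X h,
      -αb (hb (estFlow (backupField f g kb) T (estimate q k x ξ t) T z) - εb t)
          + deriv εb t + ρb t z
        ≤ fderiv ℝ hb (estFlow (backupField f g kb) T (estimate q k x ξ t) T z)
            (stateSens (backupField f g kb) T (estimate q k x ξ t) T z
              (f z + g z (k z) + estimate q k x ξ t))) :
    (∀ t ∈ Icc t₀ t₁,
      setCDhat X h hb (backupField f g kb) T (estimate q k x ξ) ε εb t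
          ⊆ setCD X h hb (backupField f g kb) T d t ∧
        setCD X h hb (backupField f g kb) T d t ⊆ safeSet X h) ∧
    ForwardInvariantAlong
      (setCDhat X h hb (backupField f g kb) T (estimate q k x ξ) ε εb) t₀ t₁ x := by
  set fcl := backupField f g kb with hfcl_def
  set v := estimate q k x ξ with hv_def
  have hfcl : C1On X fcl := hf.backupField hg hkb
  have hpos : Icc t₀ t₁ ⊆ Ici 0 := fun t ht => ht₀.trans ht.1
  have hxX : ∀ t ∈ Icc t₀ t₁, x t ∈ X := fun t ht => (hsol t ht).1
  obtain ⟨hxL, hvL⟩ := hsol.locallyLipschitzOn hf hg hd hp hq hk hkU ht₀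
  have h0T : (0 : ℝ) ∈ Icc 0 T := left_mem_Icc.2 hT.le
  have hTT : T ∈ Icc 0 T := right_mem_Icc.2 hT.le
  have hε0 : ∀ τ ∈ Icc 0 T, ∀ t ∈ Icc t₀ t₁, 0 ≤ ε τ t := fun τ hτ t ht =>
    (mul_nonneg Lh.2 (hδ0 τ hτ t ht)).trans (hε τ hτ t ht)
  have hestX : ∀ t ∈ Icc t₀ t₁, ∀ z ∈ safeSet X h, ∀ τ ∈ Icc 0 T, estFlow fcl T (v t) τ z ∈ X := by
    intro t ht z hz τ hτ
    obtain ⟨γ, hγ, hX⟩ := hest t ht z hz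
    rw [show estFlow fcl T (v t) τ z = γ τ from
      hγ.flow_eq (u := fun _ => v t) (fun σ hσ => hfcl _ (hX hσ)) hτ]
    exact hX hτ
  have hdistX : ∀ t ∈ Icc t₀ t₁, ∀ z ∈ safeSet X h, ∀ τ ∈ Icc 0 T,
      distFlow fcl T d t τ z ∈ X := by
    intro t ht z hz τ hτ
    obtain ⟨γ, hγ, hX⟩ := hdist t ht z hz
    rw [show distFlow fcl T d t τ z = γ τ from
      hγ.flow_eq (u := fun σ => d (σ + t)) (fun σ hσ => hfcl _ (hX hσ)) hτ]
    exact hX hτ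
  have htransfer : ∀ (η : Vec n → ℝ) (L : ℝ≥0), LipschitzOnWith L η X → ∀ c : ℝ,
      ∀ t ∈ Icc t₀ t₁, ∀ z ∈ safeSet X h, ∀ τ ∈ Icc 0 T, L * δmax τ t ≤ c →
      c ≤ η (estFlow fcl T (v t) τ z) → 0 ≤ η (distFlow fcl T d t τ z) := by
    intro η L hL c t ht z hz τ hτ hc hle
    have h1 := hL.dist_le_mul _ (hestX t ht z hz τ hτ) _ (hdistX t ht z hz τ hτ)
    rw [dist_comm (estFlow fcl T (v t) τ z), dist_eq_norm (distFlow fcl T d t τ z)] at h1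
    have h2 := mul_le_mul_of_nonneg_left (hδ τ hτ t ht z hz) L.2
    have h3 := (le_abs_self _).trans ((Real.dist_eq _ _).symm.le.trans h1)
    have h2' : (L : ℝ) * ‖distFlow fcl T d t τ z - estFlow fcl T (v t) τ z‖ ≤ L * δmax τ t := h2
    linarith
  refine ⟨fun t ht => ⟨?_, ?_⟩, ?_⟩
  · rintro z ⟨hzX, hzh, hzb⟩
    -- Needed first, since the deviation bound is available only over the safe set.
    have hz : z ∈ safeSet X h := ⟨hzX, by
      have := (hε0 0 h0T t ht).trans (hzh 0 h0T)
      rwa [estFlow_zero] at this⟩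
    exact ⟨hzX, fun τ hτ => htransfer h Lh hLh _ t ht z hz τ hτ (hε τ hτ t ht) (hzh τ hτ),
      htransfer hb Lhb hLhb _ t ht z hz T hTT (hεb t ht) hzb⟩
  · rintro z ⟨hzX, hzh, -⟩
    have := hzh 0 h0T
    rw [distFlow, flow_zero] at this
    exact ⟨hzX, this⟩
  intro s hs hxs
  -- Invariance conditional on safety up to time `r`.
  have hmain : ∀ r ∈ Icc s t₁, (∀ t ∈ Icc s r, 0 ≤ h (x t)) →
      x r ∈ setCDhat X h hb fcl T v ε εb r := by
    intro r hr hsafe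
    have hsub : Icc s r ⊆ Icc t₀ t₁ := Icc_subset_Icc hs.1 hr.2
    have hIoo : Ioo s r ⊆ Ioo t₀ t₁ := Ioo_subset_Ioo hs.1 hr.2
    have hCS : ∀ t ∈ Icc s r, x t ∈ safeSet X h := fun t ht => ⟨hxX t (hsub ht), hsafe t ht⟩
    have hx' : ∀ t ∈ Ioo s r, HasDerivAt x (f (x t) + g (x t) (k (x t)) + d t) t := fun t ht =>
      (hsol t (Ioo_subset_Icc_self (hIoo ht))).2.1.hasDerivAt
        (Icc_mem_nhds (hIoo ht).1 (hIoo ht).2)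
    -- Applied with `u` the disturbance and `e` its estimate: the first term is what the controller
    -- constrains, the second what the robustness term absorbs.
    have hsplit : ∀ (Λ : Vec n →L[ℝ] ℝ) (Φ Θ : Vec n →L[ℝ] Vec n) (y u e w : Vec n),
        Λ (Φ (y + u) + Θ w) = Λ (Φ (y + e)) + Λ (Φ (u - e) + Θ w) := by
      intro Λ Φ Θ y u e w
      simp only [map_add, map_sub]; ring
    have hr' : r ∈ Icc s r := right_mem_Icc.2 hr.1
    refine ⟨hxX r (hsub hr'), fun τ hτ => ?_, ?_⟩
    · refine le_estFlow_of_barrier hh hfcl hτ (hxL.mono hsub) (hvL.mono hsub)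
        (fun t ht => hest t (hsub ht) _ (hCS t ht)) (fun t ht => hεC1 τ hτ t (hpos (hsub ht)))
        hx' hα (fun t ht w hw => ?_) (hxs.2.1 τ hτ) r hr'
      have ht' := Ioo_subset_Icc_self ht
      have h1 := hcon τ hτ t (hsub ht') _ (hCS t ht')
      have h2 := hρ τ hτ t (hIoo ht) _ (hCS t ht') w hw
      rw [hsplit _ _ _ _ _ (v t)]
      linarith
    · refine le_estFlow_of_barrier hhb hfcl hTT (hxL.mono hsub) (hvL.mono hsub)
        (fun t ht => hest t (hsub ht) _ (hCS t ht)) (fun t ht => hεbC1 t (hpos (hsub ht)))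
        hx' hαb (fun t ht w hw => ?_) hxs.2.2 r hr'
      have ht' := Ioo_subset_Icc_self ht
      have h1 := hconb t (hsub ht') _ (hCS t ht')
      have h2 := hρb t (hIoo ht) _ (hCS t ht') w hw
      rw [hsplit _ _ _ _ _ (v t)]
      linarith
  have hxc : ContinuousOn x (Icc t₀ t₁) := hxL.continuousOn
  have hhx : ContinuousOn (fun t => h (x t)) (Icc t₀ t₁) := hh.continuousOn.comp hxc hxX
  have hsubs : Icc s t₁ ⊆ Icc t₀ t₁ := Icc_subset_Icc_left hs.1
  have htan : ∀ t ∈ Icc t₀ t₁, t₀ < t₁ → ∀ y ∈ X, h y = ε 0 t →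
      deriv (ε 0) t ≤ fderiv ℝ h y (f y + g y (k y) + d t) := by
    intro t ht h01 y hyX hy
    have hyC : y ∈ safeSet X h := ⟨hyX, hy ▸ hε0 0 h0T t ht⟩
    obtain ⟨K, hK⟩ := hvL.exists_lipschitzOnWith_of_compact isCompact_Icc
    have hφ : ContinuousOn (fun t => fderiv ℝ h y (f y + g y (k y) + d t)
        + α (h y - ε 0 t) - deriv (ε 0) t) (Icc t₀ t₁) := by
      refine ContinuousOn.sub (ContinuousOn.add ?_ ?_) ?_
      · exact (fderiv ℝ h y).continuous.comp_continuousOn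
          (continuousOn_const.add (hd.continuousOn.mono hpos))
      · exact hα.continuous.comp_continuousOn
          (continuousOn_const.sub ((hεC1 0 h0T).continuousOn.mono hpos))
      · exact fun r hr => (hεC1 0 h0T r (hpos hr)).continuousAt_deriv_one.continuousWithinAt
    have h1 := nonneg_of_nonneg_of_differentiableAt h01 hK hφ (fun r hr hdr => by
      have hr' := Ioo_subset_Icc_self hr
      have h2 := hcon 0 h0T r hr' y hyC
      have h3 := hρ 0 h0T r hr y hyC _ hdr.hasDerivAt
      simp only [stateSens_zero, estSens_zero, estFlow_zero, ContinuousLinearMap.id_apply,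
        zero_apply, add_zero] at h2 h3
      have h4 : f y + g y (k y) + d r = (f y + g y (k y) + v r) + (d r - v r) := by abel
      rw [h4, map_add]
      linarith) t ht
    simp only [hy, sub_self, hα.map_zero, add_zero] at h1
    linarith
  -- Continuous induction: safety up to `t` gives `h (x t) ≥ ε 0 t` by `hmain`, and this stronger
  -- inequality is what the tangency argument propagates past a boundary zero of `h`.
  have hall : Icc s t₁ ⊆ {t | 0 ≤ h (x t)} := by
    refine IsClosed.Icc_subset_of_forall_mem_nhdsGT_of_Icc_subset ?_ ?_ ?_
    · rw [inter_comm]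
      exact (hhx.mono hsubs).preimage_isClosed_of_isClosed isClosed_Icc isClosed_Ici
    · have := (hε0 0 h0T s hs).trans (hxs.2.1 0 h0T)
      rwa [estFlow_zero] at this
    · intro t ht hsafe
      have ht' : t ∈ Icc t₀ t₁ := hsubs (Ico_subset_Icc_self ht)
      have hle := (hmain t (Ico_subset_Icc_self ht) fun r hr => hsafe hr).2.1 0 h0T
      rw [estFlow_zero] at hle
      have hnhds : 𝓝[>] t ≤ 𝓝[Icc t₀ t₁] t := nhdsWithin_le_of_mem
        (mem_of_superset (Ioc_mem_nhdsGT ht.2) fun r hr => ⟨ht'.1.trans hr.1.le, hr.2⟩)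
      have hxt : Tendsto x (𝓝[>] t) (𝓝 (x t)) := (hxc t ht').mono_left hnhds
      rcases (show 0 ≤ h (x t) from hsafe (right_mem_Icc.2 ht.1)).lt_or_eq with hlt | heq
      · exact (((hhx t ht').mono_left hnhds).eventually_const_lt hlt).mono fun r hr => hr.le
      by_cases hin : x t ∈ interior (safeSet X h)
      · exact mem_of_superset (hxt (mem_interior_iff_mem_nhds.1 hin)) fun r hr => hr.2
      have hfr : x t ∈ frontier (safeSet X h) :=
        ⟨subset_closure ⟨hxX t ht', heq.le⟩, hin⟩
      -- The pushed curves leave the trajectory, so the Lipschitz bound and the tangency condition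
      -- are needed on a full neighbourhood.
      have hXn : X ∈ 𝓝 (x t) := mem_interior_iff_mem_nhds.1 (hint t ht' heq.symm)
      obtain ⟨L, N, hN, hL⟩ := locallyLipschitzOn_closedLoop hf hg hk (hxX t ht')
      rw [nhdsWithin_eq_nhds.2 hXn] at hN
      have hsub : Icc t t₁ ⊆ Icc t₀ t₁ := Icc_subset_Icc_left ht'.1
      have hev := eventually_le_of_tangent (W := fun z => f z + g z (k z)) (e := ε 0)
        (e' := deriv (ε 0)) ht.2 (fun r hr => (hsol r (hsub hr)).2.1.mono hsub)
        (hh _ (hxX t ht')) (hgrad _ hfr heq.symm) (inter_mem hN hXn)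
        (hL.mono inter_subset_left)
        (fun r hr => ((hεC1 0 h0T r (hpos (hsub hr))).differentiableAt
          one_ne_zero).hasDerivAt.hasDerivWithinAt) hle
        (fun r hr y hy hyr => htan r (hsub hr) (ht'.1.trans_lt ht.2) y hy.2 hyr)
      filter_upwards [hev, Ioc_mem_nhdsGT ht.2] with r hr hrm
      exact (hε0 0 h0T r (hsub (Ioc_subset_Icc_self hrm))).trans hr
  exact fun t ht => hmain t ⟨ht.1, ht.2⟩ fun r hr => hall ⟨hr.1, hr.2.trans ht.2⟩
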